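/- **Theorem 5 (Undirected Isoperimetric Inequality).** Let $d\ge 0$ be an integer and let $f\colon\{0,1\}^d\to\mathbb{R}$ be any function. Regard $\{0,1\}^d$ as the undirected hypercube, in which $\{x,y\}$ is an edge if and only if $x$ and $y$ differ in exactly one coordinate. For $x\in\{0,1\}^d$ let $$I_f(x)=\bigl|\{\,y : \{x,y\}\text{ is an edge and } f(x)>f(y)\,\}\bigr|,$$ and let $$\mathtt{dist}(f,\mathbf{const})=\min_{c\in\mathbb{R}}\ \Pr_{x\sim\{0,1\}^d}[f(x)\neq c],$$ where $x$ is uniformly distributed on $\{0,1\}^d$. Then $$\mathop{\mathbb{E}}_{x\sim\{0,1\}^d}\Bigl[\sqrt{I_f(x)}\Bigr]\ \ge\ \frac{\mathtt{dist}(f,\mathbf{const})}{2\sqrt2}.$$ -/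

import Mathlib

open scoped BigOperators

/-- The vertex set `{0,1}^d` of the hypercube. -/
abbrev Cube (d : ℕ) : Type := Fin d → Bool

/-- The undirected hypercube graph: `{x, y}` is an edge iff `x` and `y` differ in exactly one
coordinate. -/
def hypercubeGraph (d : ℕ) : SimpleGraph (Cube d) where
  Adj x y := hammingDist x y = 1
  symm := ⟨fun x y h => by rwa [hammingDist_comm]⟩
  loopless := ⟨fun x h => by simp at h⟩

/-- `I_f(x)`: the number of hypercube edges `{x, y}` incident on `x` with `f x > f y`. -/
noncomputable def influence {d : ℕ} (f : Cube d → ℝ) (x : Cube d) : ℕ :=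
  Set.ncard {y : Cube d | (hypercubeGraph d).Adj x y ∧ f x > f y}

/-- `E_x[φ(x)]` for `x` uniform in `{0,1}^d`. -/
noncomputable def cubeExpect {d : ℕ} (φ : Cube d → ℝ) : ℝ :=
  (∑ x : Cube d, φ x) / 2 ^ d

/-- `Pr_x[f(x) ≠ g(x)]` for `x` uniform in `{0,1}^d`. -/
noncomputable def cubeDist {d : ℕ} (f g : Cube d → ℝ) : ℝ :=
  (Set.ncard {x : Cube d | f x ≠ g x} : ℝ) / 2 ^ d

/-- `dist(f, const)`: the least distance from `f` to a constant function. -/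
noncomputable def distConst {d : ℕ} (f : Cube d → ℝ) : ℝ :=
  ⨅ c : ℝ, cubeDist f (fun _ => c)

/-- The infimum defining `distConst` is attained, so it is a minimum. -/
theorem distConst_isLeast {d : ℕ} (f : Cube d → ℝ) :
    IsLeast (Set.range fun c : ℝ => cubeDist f (fun _ => c)) (distConst f) := by
  have hfin : (Set.range fun c : ℝ => cubeDist f (fun _ => c)).Finite := by
    refine ((Set.finite_univ (α := Set (Cube d))).image
      (fun s => (Set.ncard s : ℝ) / 2 ^ d)).subset ?_
    rintro _ ⟨c, rfl⟩
    exact ⟨{x | f x ≠ c}, Set.mem_univ _, rfl⟩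
  exact ⟨(Set.range_nonempty _).csInf_mem hfin, fun _ h => csInf_le hfin.bddBelow h⟩

/-! Cut `f` at a median `m`. Every edge leaving `{f ≥ m}` or `{f > m}` strictly decreases `f`, so
`influence` dominates both exit degrees. The one-sided Talagrand bound `√2 μ(1 - μ) ≤ E √(exit
degree)` applies to each set. As `{f < m}` and `{f > m}` have measure at most 1/2, each measure is
at most `√2 E √I_f`, and their sum bounds the distance to a constant.

The Talagrand bound goes by induction on the dimension: Minkowski's inequality handles the denser
fibre, and `two_point_inequality` closes the step. -/

/-- The vertex obtained from `x` by flipping coordinate `i`. -/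
def flipAt {d : ℕ} (x : Cube d) (i : Fin d) : Cube d := Function.update x i (!x i)

/-- The number of edges leaving the set `{A = true}` at `x` (zero if `x` is outside the set). -/
noncomputable def exitDegree {d : ℕ} (A : Cube d → Bool) (x : Cube d) : ℝ :=
  ∑ i, if A x = true ∧ A (flipAt x i) = false then 1 else 0

/-- The uniform measure of the set `{A = true}`. -/
noncomputable def cubeMeasure {d : ℕ} (A : Cube d → Bool) : ℝ :=
  cubeExpect fun x => if A x = true then 1 else 0

theorem flipAt_injective {d : ℕ} (x : Cube d) : Function.Injective (flipAt x) := by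
  intro i j h
  by_contra hij
  have := congrFun h i
  simp [flipAt, Function.update_of_ne hij] at this

theorem hypercubeGraph_adj_flipAt {d : ℕ} (x : Cube d) (i : Fin d) :
    (hypercubeGraph d).Adj x (flipAt x i) := by
  change hammingDist x (flipAt x i) = 1
  unfold hammingDist
  rw [Finset.card_eq_one]
  refine ⟨i, ?_⟩
  ext j
  by_cases h : j = i
  · subst h
    rw [Finset.mem_filter, Finset.mem_singleton]
    simp [flipAt]
  · rw [Finset.mem_filter, Finset.mem_singleton]
    simp [flipAt, h]

theorem flipAt_cons_zero {d : ℕ} (b : Bool) (x : Cube d) :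
    flipAt (Fin.cons b x : Cube (d + 1)) 0 = (Fin.cons (!b) x : Cube (d + 1)) := by
  simp [flipAt]

theorem flipAt_cons_succ {d : ℕ} (b : Bool) (x : Cube d) (i : Fin d) :
    flipAt (Fin.cons b x : Cube (d + 1)) i.succ = (Fin.cons b (flipAt x i) : Cube (d + 1)) := by
  simp [flipAt, Fin.cons_update]

theorem exitDegree_nonneg {d : ℕ} (A : Cube d → Bool) (x : Cube d) : 0 ≤ exitDegree A x :=
  Finset.sum_nonneg fun i _ => by split_ifs <;> norm_num

theorem exitDegree_cons {d : ℕ} (A : Cube (d + 1) → Bool) (b : Bool) (x : Cube d) :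
    exitDegree A (Fin.cons b x : Cube (d + 1)) =
      (if A (Fin.cons b x : Cube (d + 1)) = true ∧ A (Fin.cons (!b) x : Cube (d + 1)) = false
        then 1 else 0) + exitDegree (fun y => A (Fin.cons b y : Cube (d + 1))) x := by
  unfold exitDegree
  rw [Fin.sum_univ_succ]
  simp only [flipAt_cons_zero, flipAt_cons_succ]

theorem exitDegree_le_influence {d : ℕ} (A : Cube d → Bool) (f : Cube d → ℝ)
    (hA : ∀ x y, A x = true → A y = false → f y < f x) (x : Cube d) :
    exitDegree A x ≤ influence f x := by
  unfold exitDegree influence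
  rw [Finset.sum_boole, Nat.cast_le, ← Finset.card_image_of_injective _ (flipAt_injective x),
    ← Set.ncard_coe_finset]
  refine Set.ncard_le_ncard ?_ (Set.toFinite _)
  intro y hy
  obtain ⟨i, hi, rfl⟩ := by simpa using hy
  exact ⟨hypercubeGraph_adj_flipAt x i, hA _ _ hi.1 hi.2⟩

theorem cubeExpect_succ {d : ℕ} (φ : Cube (d + 1) → ℝ) :
    cubeExpect φ = (cubeExpect (fun x : Cube d => φ (Fin.cons false x : Cube (d + 1))) +
      cubeExpect (fun x : Cube d => φ (Fin.cons true x : Cube (d + 1)))) / 2 := by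
  unfold cubeExpect
  rw [← (Fin.consEquiv fun _ : Fin (d + 1) => Bool).sum_comp, Fintype.sum_prod_type,
    Fintype.sum_bool, pow_succ]
  rw [add_comm, ← add_div, div_div]
  rfl

theorem cubeExpect_mono {d : ℕ} {φ ψ : Cube d → ℝ} (h : ∀ x, φ x ≤ ψ x) :
    cubeExpect φ ≤ cubeExpect ψ :=
  div_le_div_of_nonneg_right (Finset.sum_le_sum fun x _ => h x) (by positivity)

theorem cubeExpect_add {d : ℕ} (φ ψ : Cube d → ℝ) :
    cubeExpect (fun x => φ x + ψ x) = cubeExpect φ + cubeExpect ψ := by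
  simp [cubeExpect, Finset.sum_add_distrib, add_div]

theorem cubeExpect_sub {d : ℕ} (φ ψ : Cube d → ℝ) :
    cubeExpect (fun x => φ x - ψ x) = cubeExpect φ - cubeExpect ψ := by
  simp [cubeExpect, Finset.sum_sub_distrib, sub_div]

theorem cubeExpect_one {d : ℕ} : cubeExpect (fun _ : Cube d => 1) = 1 := by
  simp [cubeExpect]

theorem cubeExpect_nonneg {d : ℕ} {φ : Cube d → ℝ} (h : ∀ x, 0 ≤ φ x) : 0 ≤ cubeExpect φ :=
  div_nonneg (Finset.sum_nonneg fun x _ => h x) (by positivity)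

/-- Minkowski's inequality for the Euclidean norm on pairs. -/
theorem sqrt_cubeExpect_sq_add_sq_le {d : ℕ} (u v : Cube d → ℝ) :
    √(cubeExpect u ^ 2 + cubeExpect v ^ 2) ≤ cubeExpect fun x => √(u x ^ 2 + v x ^ 2) := by
  have h := norm_sum_le (Finset.univ : Finset (Cube d)) fun x => (⟨u x, v x⟩ : ℂ)
  simp only [Complex.norm_eq_sqrt_sq_add_sq, Complex.re_sum, Complex.im_sum] at h
  unfold cubeExpect
  rw [div_pow, div_pow, ← add_div, Real.sqrt_div' _ (by positivity), Real.sqrt_sq (by positivity)]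
  exact div_le_div_of_nonneg_right h (by positivity)

theorem cubeMeasure_nonneg {d : ℕ} (A : Cube d → Bool) : 0 ≤ cubeMeasure A :=
  cubeExpect_nonneg fun x => by split_ifs <;> norm_num

theorem cubeMeasure_le_one {d : ℕ} (A : Cube d → Bool) : cubeMeasure A ≤ 1 :=
  (cubeExpect_mono fun x => by split_ifs <;> norm_num).trans_eq cubeExpect_one

/-- Averaging `a` and `b` raises the mean of `p(1 - p)` by `(a - b)² / 4`; the term added under the
root of the denser fibre pays for this. -/
theorem two_point_inequality {a b s t : ℝ} (ha : a ≤ 1) (hb : 0 ≤ b) (hab : b ≤ a)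
    (hs : √2 * (a * (1 - a)) ≤ s) (ht : √2 * (b * (1 - b)) ≤ t) :
    √2 * ((a + b) / 2 * (1 - (a + b) / 2)) ≤ (√(s ^ 2 + (a - b) ^ 2) + t) / 2 := by
  have h2 : √2 ^ 2 = 2 := Real.sq_sqrt (by norm_num)
  have hp : 0 ≤ a * (1 - a) := mul_nonneg (hb.trans hab) (by linarith)
  have hs2 : 2 * (a * (1 - a)) ^ 2 ≤ s ^ 2 := by
    have := pow_le_pow_left₀ (by positivity) hs 2
    rwa [mul_pow, h2] at this
  have hδ : (a - b) ^ 2 ≤ 1 := pow_le_one₀ (by linarith) (by linarith)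
  have key : √2 * (a * (1 - a) + (a - b) ^ 2 / 2) ≤ √(s ^ 2 + (a - b) ^ 2) := by
    apply Real.le_sqrt_of_sq_le
    rw [mul_pow, h2]
    -- This is the gap between the squared sides when `s` is minimal; it is nonnegative since `a(1 -
    -- a) ≤ 1/4` and `(a - b)² ≤ 1`.
    have : 0 ≤ (a - b) ^ 2 * (1 - 2 * (a * (1 - a)) - (a - b) ^ 2 / 2) :=
      mul_nonneg (sq_nonneg _) (by nlinarith [sq_nonneg (a - 1 / 2)])
    nlinarith
  have e : √2 * ((a + b) / 2 * (1 - (a + b) / 2)) =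
      (√2 * (a * (1 - a) + (a - b) ^ 2 / 2) + √2 * (b * (1 - b))) / 2 := by ring
  rw [e]
  linarith

/-- Contribution of the fibre over `b` to the expected root of the exit degree. -/
theorem sqrt_sq_add_sq_le_fibre {d : ℕ} (A : Cube (d + 1) → Bool) (b : Bool)
    (hb : cubeMeasure (fun x : Cube d => A (Fin.cons (!b) x : Cube (d + 1))) ≤
      cubeMeasure (fun x : Cube d => A (Fin.cons b x : Cube (d + 1)))) :
    √(cubeExpect (fun x => √(exitDegree (fun y : Cube d => A (Fin.cons b y : Cube (d + 1))) x)) ^ 2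
      + (cubeMeasure (fun x : Cube d => A (Fin.cons b x : Cube (d + 1))) -
        cubeMeasure (fun x : Cube d => A (Fin.cons (!b) x : Cube (d + 1)))) ^ 2) ≤
    cubeExpect fun x : Cube d => √(exitDegree A (Fin.cons b x : Cube (d + 1))) := by
  set v : Cube d → ℝ := fun x => if A (Fin.cons b x : Cube (d + 1)) = true ∧
    A (Fin.cons (!b) x : Cube (d + 1)) = false then 1 else 0 with hv
  have hle : cubeMeasure (fun x : Cube d => A (Fin.cons b x : Cube (d + 1))) -
      cubeMeasure (fun x : Cube d => A (Fin.cons (!b) x : Cube (d + 1))) ≤ cubeExpect v := by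
    unfold cubeMeasure
    rw [← cubeExpect_sub]
    refine cubeExpect_mono fun x => ?_
    simp only [hv]
    split_ifs <;> simp_all
  refine le_trans (Real.sqrt_le_sqrt ?_) ((sqrt_cubeExpect_sq_add_sq_le
    (fun x => √(exitDegree (fun y : Cube d => A (Fin.cons b y : Cube (d + 1))) x)) v).trans_eq ?_)
  · have := pow_le_pow_left₀ (sub_nonneg.2 hb) hle 2
    linarith
  · congr 1
    funext x
    rw [exitDegree_cons, Real.sq_sqrt (exitDegree_nonneg _ _), add_comm]
    -- The indicator `v` equals its own square.
    congr 2
    simp only [hv]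
    split_ifs <;> norm_num

/-- Used for the sparser fibre, where edges across the split are discarded. -/
theorem cubeExpect_sqrt_exitDegree_fibre_le {d : ℕ} (A : Cube (d + 1) → Bool) (b : Bool) :
    cubeExpect (fun x => √(exitDegree (fun y : Cube d => A (Fin.cons b y : Cube (d + 1))) x)) ≤
      cubeExpect fun x : Cube d => √(exitDegree A (Fin.cons b x : Cube (d + 1))) := by
  refine cubeExpect_mono fun x => Real.sqrt_le_sqrt ?_
  rw [exitDegree_cons]
  split_ifs <;> linarith

/-- Talagrand's isoperimetric inequality on the hypercube, in one-sided form. -/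
theorem sqrt_two_mul_variance_le_cubeExpect_sqrt_exitDegree {d : ℕ} (A : Cube d → Bool) :
    √2 * (cubeMeasure A * (1 - cubeMeasure A)) ≤ cubeExpect fun x => √(exitDegree A x) := by
  induction d with
  | zero =>
    have h : cubeMeasure A * (1 - cubeMeasure A) = 0 := by
      have : cubeMeasure A = if A default = true then 1 else 0 := by
        rw [cubeMeasure, cubeExpect, Fintype.sum_unique, pow_zero, div_one]
        congr!
      rw [this]
      split_ifs <;> norm_num
    rw [h, mul_zero]
    exact cubeExpect_nonneg fun x => Real.sqrt_nonneg _
  | succ d ih =>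
    have hm : cubeMeasure A = (cubeMeasure (fun x : Cube d => A (Fin.cons false x : Cube (d + 1))) +
        cubeMeasure (fun x : Cube d => A (Fin.cons true x : Cube (d + 1)))) / 2 :=
      cubeExpect_succ _
    rw [hm, cubeExpect_succ]
    have h0 := ih fun x : Cube d => A (Fin.cons false x : Cube (d + 1))
    have h1 := ih fun x : Cube d => A (Fin.cons true x : Cube (d + 1))
    rcases le_total (cubeMeasure fun x : Cube d => A (Fin.cons true x : Cube (d + 1)))
      (cubeMeasure fun x : Cube d => A (Fin.cons false x : Cube (d + 1))) with h | h
    · have := two_point_inequality (cubeMeasure_le_one _) (cubeMeasure_nonneg _) h h0 h1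
      have h2 := sqrt_sq_add_sq_le_fibre A false h
      have h3 := cubeExpect_sqrt_exitDegree_fibre_le A true
      simp only [Bool.not_false] at h2
      linarith
    · have := two_point_inequality (cubeMeasure_le_one _) (cubeMeasure_nonneg _) h h1 h0
      have h2 := sqrt_sq_add_sq_le_fibre A true h
      have h3 := cubeExpect_sqrt_exitDegree_fibre_le A false
      simp only [Bool.not_true] at h2
      rw [add_comm (cubeMeasure fun x : Cube d => A (Fin.cons false x : Cube (d + 1)))]
      linarith

theorem cubeMeasure_not {d : ℕ} (A : Cube d → Bool) :
    cubeMeasure (fun x => !A x) = 1 - cubeMeasure A := by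
  rw [← cubeExpect_one (d := d), cubeMeasure, cubeMeasure, ← cubeExpect_sub]
  congr 1
  funext x
  cases A x <;> simp

theorem cubeMeasure_mono {d : ℕ} {A B : Cube d → Bool} (h : ∀ x, A x = true → B x = true) :
    cubeMeasure A ≤ cubeMeasure B := by
  refine cubeExpect_mono fun x => ?_
  have := h x
  cases hA : A x <;> cases hB : B x <;> simp_all

/-- Every real function on the cube has a median. -/
theorem exists_median {d : ℕ} (f : Cube d → ℝ) :
    ∃ m, cubeMeasure (fun x => decide (f x < m)) ≤ 1 / 2 ∧
      cubeMeasure (fun x => decide (m < f x)) ≤ 1 / 2 := by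
  classical
  set S : Finset (Cube d) :=
    Finset.univ.filter fun x => 1 / 2 ≤ cubeMeasure fun y => decide (f y ≤ f x) with hS
  have hne : S.Nonempty := by
    obtain ⟨x, -, hx⟩ := Finset.exists_max_image Finset.univ f Finset.univ_nonempty
    refine ⟨x, Finset.mem_filter.2 ⟨Finset.mem_univ _, ?_⟩⟩
    have : cubeMeasure (fun y => decide (f y ≤ f x)) = 1 := by
      rw [← cubeExpect_one (d := d), cubeMeasure]
      congr 1
      funext y
      simp [hx y (Finset.mem_univ _)]
    rw [this]
    norm_num
  obtain ⟨x, hxS, hx⟩ := Finset.exists_min_image S f hne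
  refine ⟨f x, ?_, ?_⟩
  · by_contra! hlt
    have hT : (Finset.univ.filter fun y => f y < f x).Nonempty := by
      by_contra hT
      have h0 : cubeMeasure (fun y => decide (f y < f x)) = 0 := by
        have hall : ∀ y, ¬ f y < f x := by
          intro y hy
          exact hT ⟨y, by simpa using hy⟩
        simp [cubeMeasure, cubeExpect, hall]
      rw [h0] at hlt
      norm_num at hlt
    -- With `f z` the largest value below `f x`, `{f < f x}` lies in `{f ≤ f z}`, so `z ∈ S`,
    -- against the minimality of `f x`.
    obtain ⟨z, hz, hzmax⟩ := Finset.exists_max_image _ f hT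
    have hzx : f z < f x := (Finset.mem_filter.1 hz).2
    refine absurd (hx z (Finset.mem_filter.2 ⟨Finset.mem_univ _, hlt.le.trans ?_⟩)) hzx.not_ge
    refine cubeMeasure_mono fun y hy => ?_
    exact decide_eq_true (hzmax y (by simpa using hy))
  · have h := cubeMeasure_not fun y => decide (f y ≤ f x)
    have e : (fun y => !decide (f y ≤ f x)) = fun y => decide (f x < f y) := by
      funext y
      simp [← not_le]
    rw [e] at h
    have := (Finset.mem_filter.1 hxS).2
    linarith

theorem cubeDist_const_eq {d : ℕ} (f : Cube d → ℝ) (m : ℝ) :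
    cubeDist f (fun _ => m) = cubeMeasure (fun x => decide (f x < m)) +
      cubeMeasure (fun x => decide (m < f x)) := by
  classical
  have h : cubeDist f (fun _ => m) = cubeExpect fun x => if f x ≠ m then (1 : ℝ) else 0 := by
    unfold cubeDist cubeExpect
    rw [Finset.sum_boole, ← Set.ncard_coe_finset]
    simp
  rw [h, cubeMeasure, cubeMeasure, ← cubeExpect_add]
  congr 1
  funext x
  rcases lt_trichotomy (f x) m with h | h | h
  · simp [h, h.ne, h.not_gt]
  · simp [h]
  · simp [h, h.ne', h.not_gt]

theorem cubeExpect_sqrt_influence_ge {d : ℕ} (A : Cube d → Bool) (f : Cube d → ℝ)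
    (hA : ∀ x y, A x = true → A y = false → f y < f x) :
    √2 * (cubeMeasure A * (1 - cubeMeasure A)) ≤ cubeExpect fun x => √(influence f x) :=
  (sqrt_two_mul_variance_le_cubeExpect_sqrt_exitDegree A).trans
    (cubeExpect_mono fun x => Real.sqrt_le_sqrt (exitDegree_le_influence A f hA x))

theorem theorem5 (d : ℕ) (f : Cube d → ℝ) :
    cubeExpect (fun x => Real.sqrt (influence f x)) ≥ distConst f / (2 * Real.sqrt 2) := by
  obtain ⟨m, hlo, hhi⟩ := exists_median f
  have hdist : distConst f ≤ cubeDist f (fun _ => m) := (distConst_isLeast f).2 ⟨m, rfl⟩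
  rw [cubeDist_const_eq] at hdist
  have h1 := cubeExpect_sqrt_influence_ge (fun x => !decide (f x < m)) f fun x y hx hy => by
    simp only [Bool.not_eq_true', decide_eq_false_iff_not, not_lt, Bool.not_eq_false',
      decide_eq_true_eq] at hx hy
    exact hy.trans_le hx
  have h2 := cubeExpect_sqrt_influence_ge (fun x => decide (m < f x)) f fun x y hx hy => by
    simp only [decide_eq_false_iff_not, not_lt, decide_eq_true_eq] at hx hy
    exact hy.trans_lt hx
  rw [cubeMeasure_not] at h1
  have ha := cubeMeasure_nonneg fun x => decide (f x < m)
  have he := cubeMeasure_nonneg fun x => decide (m < f x)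
  set a := cubeMeasure fun x => decide (f x < m)
  set e := cubeMeasure fun x => decide (m < f x)
  set E := cubeExpect fun x => √(influence f x)
  have h2sq : √2 * √2 = 2 := Real.mul_self_sqrt (by norm_num)
  have h2pos : 0 < √2 := by positivity
  -- From `a ≤ 1/2`: `a ≤ 2a(1 - a)`.
  have h1' : a ≤ √2 * E := by
    have := mul_le_mul_of_nonneg_left h1 h2pos.le
    rw [← mul_assoc, h2sq] at this
    nlinarith
  have h2' : e ≤ √2 * E := by
    have := mul_le_mul_of_nonneg_left h2 h2pos.le
    rw [← mul_assoc, h2sq] at this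
    nlinarith
  rw [ge_iff_le, div_le_iff₀ (by positivity)]
  linarith
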